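/- Let $R$ be an associative ring with identity that is abelian, meaning that every idempotent of $R$ is central, and let $n \ge 1$ be an integer. Write $J(R)$ for the Jacobson radical of $R$, $M_n(R)$ for the ring of $n \times n$ matrices over $R$, and $M_n(J(R))$ for the ideal of $M_n(R)$ consisting of the matrices with all entries in $J(R)$. A ring is called nil-clean if each of its elements is the sum of an idempotent and a nilpotent element, and Boolean if each of its elements is idempotent; an ideal is called nil if each of its elements is nilpotent. Then the following are equivalent: 1. $M_n(R)$ is nil-clean. 2. $R/J(R)$ is Boolean and $M_n(J(R))$ is nil. -/

import Mathlib

/-- A ring is abelian if every idempotent is central. -/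
def IsAbelianRing (R : Type*) [Ring R] : Prop :=
  ∀ e : R, IsIdempotentElem e → e ∈ Subring.center R

/-- An element is nil-clean if subtracting some idempotent from it leaves a nilpotent. -/
def IsNilCleanElem {R : Type*} [Ring R] (a : R) : Prop :=
  ∃ e : R, IsIdempotentElem e ∧ IsNilpotent (a - e)

/-- A ring is nil-clean if every element is nil-clean. -/
def IsNilCleanRing (R : Type*) [Ring R] : Prop :=
  ∀ a : R, IsNilCleanElem a

/-- A ring is Boolean if every element is idempotent. -/
def IsBooleanRing (R : Type*) [Ring R] : Prop :=
  ∀ a : R, IsIdempotentElem a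

/-- An ideal is nil if each of its elements is nilpotent. -/
def IsNilIdeal {R : Type*} [Ring R] (I : Ideal R) : Prop :=
  ∀ a ∈ I, IsNilpotent a

/-! For (1) ⇒ (2): a nil-clean ring has nil Jacobson radical, and the radical of the matrix ring
contains `M_n(J(R))`. Nil-clean rings are exchange, a property the matrix ring hands down to `R`;
being abelian, `R` then has two-sided maximal left ideals `M`. Each `R/M` is a division ring with
nil-clean matrices, which forces `R/M = {0, 1}`, so `a * a - a` lies in every `M`. For (2) ⇒ (1):
nil-cleanness lifts modulo the nil ideal `M_n(J(R))`, leaving matrices over a Boolean ring. Finitely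
many entries generate a finite Boolean ring, a product of two-element fields, where Krylov subspaces
reduce the claim to companion matrices. -/

theorem RingHom.mapMatrix_surjective {R S ι : Type*} [Ring R] [Ring S] [Fintype ι]
    [DecidableEq ι] {f : R →+* S} (hf : Function.Surjective f) :
    Function.Surjective (f.mapMatrix (m := ι)) := by
  intro A
  choose B hB using fun i j => hf (A i j)
  exact ⟨Matrix.of B, by ext i j; simp [hB]⟩

theorem IsNilCleanElem.map {R S : Type*} [Ring R] [Ring S] (f : R →+* S) {a : R}
    (h : IsNilCleanElem a) : IsNilCleanElem (f a) := by
  obtain ⟨e, he, hn⟩ := h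
  exact ⟨f e, he.map f, by simpa using hn.map f⟩

theorem IsNilCleanRing.of_surjective {R S : Type*} [Ring R] [Ring S] (h : IsNilCleanRing R)
    (f : R →+* S) (hf : Function.Surjective f) : IsNilCleanRing S := by
  intro b
  obtain ⟨a, rfl⟩ := hf b
  exact (h a).map f

/-! ### Exchange property and maximal left ideals -/

/-- Nil-clean rings are exchange rings. -/
theorem IsNilCleanRing.exists_exchange {S : Type*} [Ring S] (h : IsNilCleanRing S) (x : S) :
    ∃ f s t : S, IsIdempotentElem f ∧ f = s * x ∧ 1 - f = t * (1 - x) := by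
  -- Decomposing `x - 1` rather than `x` makes `x - e` equal to one plus a nilpotent, hence a unit.
  obtain ⟨e, he, hn⟩ := h (x - 1)
  obtain ⟨u, hu⟩ : IsUnit (x - e) := by
    have := hn.isUnit_one_add
    rwa [show 1 + (x - 1 - e) = x - e by abel] at this
  have hx : x = e + u := by rw [hu]; abel
  have he' : e * e = e := he
  have key : (↑u⁻¹ : S) * (1 - e) * u = x - ↑u⁻¹ * ((x - 1) * x) := by
    have : (1 - e) * (u : S) = u * x - (x - 1) * x := by
      rw [hx]
      simp only [sub_mul, add_mul, mul_add, he', one_mul]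
      abel
    rw [mul_assoc, this, mul_sub, Units.inv_mul_cancel_left]
  refine ⟨↑u⁻¹ * (1 - e) * u, 1 - ↑u⁻¹ * (x - 1), 1 - ↑u⁻¹ * x, ?_, ?_, ?_⟩
  · have h1 : (1 - e) * (1 - e) = 1 - e := he.one_sub
    change (↑u⁻¹ * (1 - e) * u) * (↑u⁻¹ * (1 - e) * u) = (↑u⁻¹ : S) * (1 - e) * u
    calc (↑u⁻¹ * (1 - e) * u) * (↑u⁻¹ * (1 - e) * u)
        = (↑u⁻¹ : S) * (1 - e) * (u * ↑u⁻¹) * (1 - e) * u := by simp only [mul_assoc]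
      _ = _ := by rw [Units.mul_inv, mul_one, mul_assoc (↑u⁻¹ : S), h1]
  · rw [key]; noncomm_ring
  · rw [key]; noncomm_ring

/-- The exchange property passes from a matrix ring to its coefficient ring. -/
theorem IsNilCleanRing.exists_exchange_of_matrix {R ι : Type*} [Ring R] [Fintype ι] [DecidableEq ι]
    (i : ι) (h : IsNilCleanRing (Matrix ι ι R)) (a : R) :
    ∃ g s t : R, IsIdempotentElem g ∧ g = s * a ∧ 1 - g = t * (1 - a) := by
  obtain ⟨f, s, t, hf, hs, ht⟩ := h.exists_exchange (Matrix.single i i a)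
  -- `f` lives in column `i`, so its `(i, i)` entry is itself idempotent.
  have hcol : ∀ j k, k ≠ i → f j k = 0 := by
    intro j k hk
    rw [hs, Matrix.mul_single_apply_of_ne (hbj := hk)]
  refine ⟨f i i, s i i, t i i, ?_, ?_, ?_⟩
  · have := congrFun (congrFun hf.eq i) i
    rw [Matrix.mul_apply, Finset.sum_eq_single i] at this
    · exact this
    · intro j _ hj; rw [hcol i j hj, zero_mul]
    · simp
  · rw [hs, Matrix.mul_single_apply_same]
  · have := congrFun (congrFun ht i) i
    rw [mul_sub, mul_one, Matrix.sub_apply, Matrix.sub_apply, Matrix.one_apply_eq,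
      Matrix.mul_single_apply_same] at this
    rw [this, mul_sub, mul_one]

/-- In an abelian exchange ring every maximal left ideal is two-sided. -/
theorem IsAbelianRing.isTwoSided_of_isMaximal {R : Type*} [Ring R] (hR : IsAbelianRing R)
    (hex : ∀ a : R, ∃ g s t : R, IsIdempotentElem g ∧ g = s * a ∧ 1 - g = t * (1 - a))
    (M : Ideal R) (hM : M.IsMaximal) : M.IsTwoSided := by
  refine ⟨fun {m} r hm => ?_⟩
  by_contra hmr
  obtain ⟨s, hs⟩ := Ideal.IsMaximal.exists_inv hM hmr
  obtain ⟨m', hm', hs⟩ := hs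
  obtain ⟨g, t, t', hg, hgt, hgt'⟩ := hex (s * (m * r))
  have h1g : 1 - g ∈ M := by
    rw [hgt', ← hs, add_sub_cancel_left]
    exact M.mul_mem_left _ hm'
  have hgM : g ∉ M := fun h => hM.ne_top ((Ideal.eq_top_iff_one _).2 (by
    simpa using M.add_mem h1g h))
  have hgc : ∀ x, x * g = g * x := Subring.mem_center_iff.1 (hR g hg)
  set p := t * s * m with hp
  have hpM : p ∈ M := M.mul_mem_left _ hm
  have hpr : p * r = g := by rw [hgt, hp]; simp only [mul_assoc]
  have hgg : g * g = g := hg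
  -- Abelian rings are directly finite: in the corner cut out by the central `g`, `p * r = g` forces
  -- `r * p` to act as `g`, which puts `g` in `M`.
  have hh : IsIdempotentElem (g * r * p) := by
    change g * r * p * (g * r * p) = g * r * p
    calc g * r * p * (g * r * p) = g * r * (p * g) * r * p := by simp only [mul_assoc]
      _ = g * (r * g) * (p * r) * p := by rw [hgc p]; simp only [mul_assoc]
      _ = g * g * r * (g * p) := by rw [hpr, hgc r]; simp only [mul_assoc]
      _ = g * (r * g) * p := by rw [hgg]; simp only [mul_assoc]
      _ = g * g * r * p := by rw [hgc r]; simp only [mul_assoc]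
      _ = g * r * p := by rw [hgg]
  have hhc := Subring.mem_center_iff.1 (hR _ hh)
  apply hgM
  have : g = g * r * p := by
    calc g = g * g * g := by rw [hgg, hgg]
      _ = g * (p * r) * (p * r) := by rw [hpr]
      _ = (p * g) * r * (p * r) := by rw [hgc p]; simp only [mul_assoc]
      _ = p * (g * r * p) * r := by simp only [mul_assoc]
      _ = (g * r * p) * (p * r) := by rw [hhc p]; simp only [mul_assoc]
      _ = g * r * p * g := by rw [hpr]
      _ = g * g * r * p := by rw [hgc]; simp only [mul_assoc]
      _ = g * r * p := by rw [hgg]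
  rw [this]
  exact M.mul_mem_left _ hpM

/-! ### Matrices over a division ring -/

open Matrix in
/-- A division ring with a nil-clean matrix ring has only two elements. -/
theorem IsNilCleanRing.eq_zero_or_one_of_matrix {D ι : Type*} [DivisionRing D] [Fintype ι]
    [DecidableEq ι] (i : ι) (h : IsNilCleanRing (Matrix ι ι D)) (a : D) : a = 0 ∨ a = 1 := by
  by_contra! ha
  obtain ⟨ha0, ha1⟩ := ha
  obtain ⟨E, hE, k, hk⟩ := h (Matrix.single i i a)
  set N := Matrix.single i i a - E with hN
  set w : ι → D := Pi.single i 1 with hw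
  have hwi : w i = 1 := by simp [hw]
  have hA : ∀ v : ι → D, v ᵥ* Matrix.single i i a = (v i * a) • w := by
    intro v
    ext j
    rw [Matrix.vecMul, dotProduct, Finset.sum_eq_single i]
    · by_cases hj : j = i
      · subst hj; simp [hw]
      · simp [hw, hj, Ne.symm hj]
    · intro b _ hb; simp [hb.symm]
    · simp
  have hvN : ∀ v : ι → D, v ᵥ* N = (v i * a) • w - v ᵥ* E := by
    intro v; rw [hN, Matrix.vecMul_sub, hA]
  have hpow : ∀ (v : ι → D) (c : D), v ᵥ* N = c • v → c ≠ 0 → v = 0 := by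
    intro v c hv hc
    have : ∀ m : ℕ, v ᵥ* N ^ m = c ^ m • v := by
      intro m
      induction m with
      | zero => simp
      | succ m ih =>
        rw [pow_succ, ← Matrix.vecMul_vecMul, ih, Matrix.smul_vecMul, hv, smul_smul, pow_succ]
    have h0 := this k
    rw [hk, Matrix.vecMul_zero] at h0
    exact (smul_eq_zero.1 h0.symm).resolve_left (pow_ne_zero _ hc)
  -- `N` acts as `-1` on such `v`. So coordinate `i` is injective on the image of `E`, which is a
  -- line.
  have hinj : ∀ v : ι → D, v ᵥ* E = v → v i = 0 → v = 0 := by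
    intro v hv hv0
    refine hpow v (-1) ?_ (by simp)
    rw [hvN, hv, hv0]; simp
  have hEE : ∀ v : ι → D, (v ᵥ* E) ᵥ* E = v ᵥ* E := by
    intro v; rw [Matrix.vecMul_vecMul, hE.eq]
  obtain ⟨v, hv⟩ : ∃ v : ι → D, v ᵥ* E ≠ 0 := by
    by_contra! h0
    have hw0 := hpow w a (by rw [hvN, h0, hwi]; simp) ha0
    have := congrFun hw0 i
    rw [hwi] at this
    exact one_ne_zero this
  have hvi : (v ᵥ* E) i ≠ 0 := fun h0 => hv (hinj _ (hEE v) h0)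
  set u : ι → D := ((v ᵥ* E) i)⁻¹ • (v ᵥ* E) with hu
  have hui : u i = 1 := by simp [hu, hvi]
  have huE : u ᵥ* E = u := by rw [hu, Matrix.smul_vecMul, hEE]
  have hrank : ∀ v : ι → D, v ᵥ* E = (v ᵥ* E) i • u := by
    intro v
    rw [← sub_eq_zero]
    apply hinj
    · rw [Matrix.sub_vecMul, Matrix.smul_vecMul, hEE, huE]
    · simp [hui]
  set c := (w ᵥ* E) i with hc
  have hwN : w ᵥ* N = a • w - c • u := by rw [hvN, hrank w, hwi, one_mul]
  have huN : u ᵥ* N = a • w - u := by rw [hvN, huE, hui, one_mul]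
  -- On the span of `w` and `u`, `N` has the eigenvalue `a - 1` if `c = 1`, and is onto otherwise.
  by_cases hc1 : c = 1
  · rw [hc1, one_smul] at hwN
    have hz : a • w - u = 0 := by
      refine hpow _ (a - 1) ?_ (sub_ne_zero.2 ha1)
      rw [Matrix.sub_vecMul, Matrix.smul_vecMul, hwN, huN, sub_smul, one_smul]
    have := congrFun hz i
    simp only [Pi.sub_apply, Pi.smul_apply, hwi, hui, smul_eq_mul, mul_one, Pi.zero_apply] at this
    exact ha1 (sub_eq_zero.1 this)
  · have hc1' : c - 1 ≠ 0 := sub_ne_zero.2 hc1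
    have hu1 : ((c - 1)⁻¹ • (u - w)) ᵥ* N = u := by
      rw [Matrix.smul_vecMul, Matrix.sub_vecMul, hwN, huN, inv_smul_eq_iff₀ hc1', sub_smul,
        one_smul]
      abel
    have hw1 : (a⁻¹ • (u + (c - 1)⁻¹ • (u - w))) ᵥ* N = w := by
      rw [Matrix.smul_vecMul, Matrix.add_vecMul, hu1, huN, inv_smul_eq_iff₀ ha0]
      abel
    have hsurj : ∀ m : ℕ, ∀ x y : D, ∃ x' y' : D, (x' • w + y' • u) ᵥ* N ^ m = x • w + y • u := by
      intro m
      induction m with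
      | zero => intro x y; exact ⟨x, y, by simp⟩
      | succ m ih =>
        intro x y
        obtain ⟨x', y', h'⟩ := ih (-(x * a⁻¹ * (c - 1)⁻¹) - y * (c - 1)⁻¹)
          (x * a⁻¹ + x * a⁻¹ * (c - 1)⁻¹ + y * (c - 1)⁻¹)
        refine ⟨x', y', ?_⟩
        rw [pow_succ, ← Matrix.vecMul_vecMul, h']
        calc _ = (x • a⁻¹ • (u + (c - 1)⁻¹ • (u - w)) + y • (c - 1)⁻¹ • (u - w)) ᵥ* N := by
              congr 1
              simp only [smul_add, smul_sub, smul_smul, add_smul, sub_smul, neg_smul,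
                mul_assoc]
              abel
          _ = x • w + y • u := by
              rw [Matrix.add_vecMul, Matrix.smul_vecMul x, Matrix.smul_vecMul y, hw1, hu1]
    obtain ⟨x', y', h'⟩ := hsurj k 1 0
    rw [hk, Matrix.vecMul_zero, one_smul, zero_smul, add_zero] at h'
    have := congrFun h' i
    rw [hwi] at this
    exact zero_ne_one this

/-! ### Consequences for the Jacobson radical -/

/-- The Jacobson radical of a nil-clean ring is nil. -/
theorem IsNilCleanRing.isNilpotent_of_mem_jacobson {S : Type*} [Ring S] (h : IsNilCleanRing S)
    {a : S} (ha : a ∈ Ring.jacobson S) : IsNilpotent a := by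
  obtain ⟨e, he, k, hk⟩ := h a
  -- Modulo the radical, `e` is both idempotent and nilpotent.
  have heJ : e ∈ Ring.jacobson S := by
    rw [← Ideal.Quotient.eq_zero_iff_mem]
    have hq := congrArg (Ideal.Quotient.mk (Ring.jacobson S)) hk
    rw [map_pow, map_sub, Ideal.Quotient.eq_zero_iff_mem.2 ha, zero_sub, map_zero] at hq
    have hen : IsNilpotent (Ideal.Quotient.mk (Ring.jacobson S) e) := isNilpotent_neg_iff.1 ⟨k, hq⟩
    obtain ⟨m, hm⟩ := hen
    have hie := he.map (Ideal.Quotient.mk (Ring.jacobson S))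
    have := hie.pow_succ_eq m
    rw [← this, pow_succ, hm, zero_mul]
  have he0 : e = 0 := by
    rw [← Ideal.jacobson_bot] at heJ
    obtain ⟨s, hs⟩ := Ideal.exists_mul_sub_mem_of_sub_one_mem_jacobson (1 - e)
      (by simpa using heJ)
    have hs1 : s * (1 - e) = 1 := sub_eq_zero.1 hs
    calc e = s * (1 - e) * e := by rw [hs1, one_mul]
      _ = s * (e - e * e) := by noncomm_ring
      _ = 0 := by rw [he.eq, sub_self, mul_zero]
  subst he0
  exact ⟨k, by simpa using hk⟩

theorem IsNilCleanRing.isNilIdeal_matrix_jacobson {R ι : Type*} [Ring R] [Fintype ι] [DecidableEq ι]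
    (h : IsNilCleanRing (Matrix ι ι R)) : IsNilIdeal ((Ring.jacobson R).matrix ι) := by
  intro a ha
  apply h.isNilpotent_of_mem_jacobson
  rw [← Ideal.jacobson_bot] at ha ⊢
  simpa using Ideal.matrix_jacobson_le (⊥ : Ideal R) ha

/-- The radical is the intersection of the maximal left ideals, so it suffices to work in each
division ring `R ⧸ M`. -/
theorem IsNilCleanRing.isBooleanRing_quotient_jacobson {R ι : Type*} [Ring R] [Fintype ι]
    [DecidableEq ι] (hR : IsAbelianRing R) (i : ι) (h : IsNilCleanRing (Matrix ι ι R)) :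
    IsBooleanRing (R ⧸ Ring.jacobson R) := by
  intro b
  obtain ⟨a, rfl⟩ := Ideal.Quotient.mk_surjective b
  change _ * _ = _
  rw [← map_mul, Ideal.Quotient.eq, ← Ideal.jacobson_bot, Ideal.jacobson, Ideal.mem_sInf]
  rintro M ⟨-, hM⟩
  have hM2 : M.IsTwoSided := hR.isTwoSided_of_isMaximal (h.exists_exchange_of_matrix i) M hM
  have : Nontrivial (R ⧸ M) := Ideal.Quotient.nontrivial_iff.2 hM.ne_top
  have hinv : ∀ x : R ⧸ M, x ≠ 0 → ∃ y, y * x = 1 := by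
    intro x hx
    obtain ⟨r, rfl⟩ := Ideal.Quotient.mk_surjective x
    rw [Ne, Ideal.Quotient.eq_zero_iff_mem] at hx
    obtain ⟨s, m, hm, hs⟩ := Ideal.IsMaximal.exists_inv hM hx
    refine ⟨Ideal.Quotient.mk M s, ?_⟩
    have := congrArg (Ideal.Quotient.mk M) hs
    simpa [Ideal.Quotient.eq_zero_iff_mem.2 hm] using this
  have hunit : ∀ x : R ⧸ M, IsUnit x ∨ x = 0 := by
    intro x
    by_cases hx : x = 0
    · exact Or.inr hx
    obtain ⟨y, hy⟩ := hinv x hx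
    obtain ⟨z, hz⟩ := hinv y (by rintro rfl; simp at hy)
    have hzx : z = x := by rw [← mul_one z, ← hy, ← mul_assoc, hz, one_mul]
    exact Or.inl ⟨⟨x, y, hzx ▸ hz, hy⟩, rfl⟩
  have hD : IsNilCleanRing (Matrix ι ι (R ⧸ M)) := by
    exact h.of_surjective (Ideal.Quotient.mk M).mapMatrix
      (RingHom.mapMatrix_surjective Ideal.Quotient.mk_surjective)
  let _ : DivisionRing (R ⧸ M) := DivisionRing.ofIsUnitOrEqZero hunit
  rw [← Ideal.Quotient.eq_zero_iff_mem, map_sub, map_mul]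
  rcases IsNilCleanRing.eq_zero_or_one_of_matrix i hD (Ideal.Quotient.mk M a) with h0 | h1
  · rw [h0]; simp
  · rw [h1]; simp

/-! ### Transfer and lifting of nil-cleanness -/

theorem IsNilCleanElem.of_ringEquiv {R S : Type*} [Ring R] [Ring S] (f : R ≃+* S) {a : R}
    (h : IsNilCleanElem (f a)) : IsNilCleanElem a := by
  obtain ⟨e, he, hn⟩ := h
  exact ⟨f.symm e, he.map f.symm, by simpa using hn.map f.symm⟩

theorem IsIdempotentElem.isNilCleanElem {R : Type*} [Ring R] {a : R} (h : IsIdempotentElem a) :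
    IsNilCleanElem a :=
  ⟨a, h, by simp⟩

/-- Nil-clean elements lift along surjections with nil kernel. -/
theorem IsNilCleanRing.of_ker_isNilpotent {R S : Type*} [Ring R] [Ring S] (f : R →+* S)
    (hf : Function.Surjective f) (hker : ∀ x ∈ RingHom.ker f, IsNilpotent x)
    (h : IsNilCleanRing S) : IsNilCleanRing R := by
  intro a
  obtain ⟨e, he, k, hk⟩ := h (f a)
  obtain ⟨e', he', rfl⟩ := exists_isIdempotentElem_eq_of_ker_isNilpotent f hker e
    (RingHom.mem_range.2 (hf e)) he
  refine ⟨e', he', ?_⟩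
  have : (a - e') ^ k ∈ RingHom.ker f := by rw [RingHom.mem_ker, map_pow, map_sub, hk]
  obtain ⟨m, hm⟩ := hker _ this
  exact ⟨k * m, by rw [pow_mul, hm]⟩

theorem IsNilCleanRing.pi {ι : Type*} [Finite ι] {R : ι → Type*} [∀ i, Ring (R i)]
    (h : ∀ i, IsNilCleanRing (R i)) : IsNilCleanRing (∀ i, R i) := by
  have := Fintype.ofFinite ι
  intro a
  choose e he k hk using fun i => h i (a i)
  refine ⟨e, funext fun i => he i, Finset.univ.sup k, funext fun i => ?_⟩
  exact pow_eq_zero_of_le (Finset.le_sup (Finset.mem_univ i)) (hk i)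

/-! ### Endomorphisms over the two-element field -/

section Field

variable {K : Type*} [Field K]

/-- An endomorphism is nil-clean as soon as it is so on an invariant subspace and on the quotient. -/
theorem isNilCleanElem_of_invariant {V : Type*} [AddCommGroup V] [Module K V]
    (T : Module.End K V) (W : Submodule K V) (hW : ∀ x ∈ W, T x ∈ W)
    (h₁ : IsNilCleanElem (R := Module.End K W) (T.restrict hW))
    (h₂ : IsNilCleanElem (R := Module.End K (V ⧸ W)) (W.mapQ W T hW)) : IsNilCleanElem T := by
  obtain ⟨E₁, hE₁, k₁, hk₁⟩ := h₁
  obtain ⟨E₂, hE₂, k₂, hk₂⟩ := h₂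
  obtain ⟨s, hs⟩ := W.mkQ.exists_rightInverse_of_surjective W.range_mkQ
  have hqs : ∀ y, W.mkQ (s y) = y := fun y => LinearMap.congr_fun hs y
  have hqW : ∀ x : W, W.mkQ x = 0 := fun x => (Submodule.Quotient.mk_eq_zero W).2 x.2
  let p : V →ₗ[K] W := ((LinearMap.id : V →ₗ[K] V) - s ∘ₗ W.mkQ).codRestrict W fun x => by
    rw [← Submodule.Quotient.mk_eq_zero, ← Submodule.mkQ_apply, LinearMap.sub_apply, map_sub,
      LinearMap.comp_apply, hqs, LinearMap.id_apply, sub_self]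
  have hp : ∀ x, (p x : V) = x - s (W.mkQ x) := fun x => rfl
  have hpW : ∀ x : W, p x = x := fun x => Subtype.ext (by rw [hp, hqW, map_zero, sub_zero])
  have hps : ∀ y, p (s y) = 0 := fun y => Subtype.ext (by rw [hp, hqs, sub_self]; rfl)
  -- Block diagonal for the splitting by `s`, so `T - E` is block triangular with nilpotent diagonal
  -- blocks.
  let E : Module.End K V := W.subtype ∘ₗ E₁ ∘ₗ p + s ∘ₗ E₂ ∘ₗ W.mkQ
  have hE : ∀ x, E x = (E₁ (p x) : V) + s (E₂ (W.mkQ x)) := fun x => rfl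
  have hE₁' : ∀ x, E₁ (E₁ x) = E₁ x := fun x => LinearMap.congr_fun hE₁.eq x
  have hE₂' : ∀ x, E₂ (E₂ x) = E₂ x := fun x => LinearMap.congr_fun hE₂.eq x
  refine ⟨E, LinearMap.ext fun x => ?_, k₁ + k₂, LinearMap.ext fun x => ?_⟩
  · rw [Module.End.mul_apply, hE (E x)]
    have h1 : p (E x) = E₁ (p x) := by rw [hE, map_add, hpW, hps, add_zero]
    have h2 : W.mkQ (E x) = E₂ (W.mkQ x) := by rw [hE, map_add, hqW, hqs, zero_add]
    rw [h1, h2, hE₁', hE₂', hE]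
  · have hq : ∀ k y, W.mkQ (((T - E) ^ k) y) = ((W.mapQ W T hW - E₂) ^ k) (W.mkQ y) := by
      intro k
      induction k with
      | zero => intro y; rfl
      | succ k ih =>
        intro y
        rw [pow_succ, pow_succ, Module.End.mul_apply, ih, Module.End.mul_apply]
        congr 1
        rw [LinearMap.sub_apply, map_sub, hE, map_add, hqW, hqs, zero_add]
        rfl
    have hι : ∀ k (y : W), ((T - E) ^ k) (y : V) = (((T.restrict hW - E₁) ^ k) y : W) := by
      intro k
      induction k with
      | zero => intro y; rfl
      | succ k ih =>
        intro y
        rw [pow_succ, pow_succ, Module.End.mul_apply, Module.End.mul_apply, ← ih]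
        congr 1
        rw [LinearMap.sub_apply, hE, hpW, hqW, map_zero, map_zero, add_zero]
        rfl
    have hmem : ((T - E) ^ k₂) x ∈ W := by
      rw [← Submodule.Quotient.mk_eq_zero, ← Submodule.mkQ_apply, hq, hk₂]
      rfl
    rw [pow_add, Module.End.mul_apply]
    have := hι k₁ ⟨_, hmem⟩
    rw [hk₁] at this
    exact this

/-- A nilpotency criterion: the orbit of a single vector spans and dies out. -/
theorem isNilpotent_of_span_orbit {V : Type*} [AddCommGroup V] [Module K V]
    (N : Module.End K V) (v : V) (d : ℕ) (hd : (N ^ d) v = 0)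
    (hspan : ⊤ ≤ Submodule.span K (Set.range fun i : ℕ => (N ^ i) v)) : IsNilpotent N := by
  refine ⟨d, LinearMap.ext fun x => ?_⟩
  have hle : Submodule.span K (Set.range fun i : ℕ => (N ^ i) v) ≤ LinearMap.ker (N ^ d) := by
    rw [Submodule.span_le]
    rintro _ ⟨i, rfl⟩
    rw [SetLike.mem_coe, LinearMap.mem_ker, ← Module.End.mul_apply, ← pow_add, add_comm, pow_add,
      Module.End.mul_apply, hd, map_zero]
  exact hle (hspan trivial)

/-- A cyclic endomorphism of trace `1` is nil-clean. -/
theorem isNilCleanElem_of_cyclic_of_coord_eq_one {V : Type*} [AddCommGroup V] [Module K V]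
    (T : Module.End K V) (f : ℕ → V) (hf : ∀ i, T (f i) = f (i + 1)) (m : ℕ)
    (b : Module.Basis (Fin (m + 1)) K V) (hb : ∀ i, b i = f i)
    (ht : b.coord (Fin.last m) (f (m + 1)) = 1) : IsNilCleanElem T := by
  set φ := b.coord (Fin.last m) with hφ
  -- The last column of the companion matrix; `T - E` is the plain shift.
  let E : Module.End K V := φ.smulRight (f (m + 1))
  have hE : ∀ x, E x = φ x • f (m + 1) := fun x => rfl
  refine ⟨E, LinearMap.ext fun x => ?_, ?_⟩
  · rw [Module.End.mul_apply, hE, hE, map_smul, ht, smul_eq_mul, mul_one]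
  have hφf : ∀ i, i < m → φ (f i) = 0 := by
    intro i hi
    have := hb ⟨i, by omega⟩
    rw [hφ, ← this, Module.Basis.coord_apply, Module.Basis.repr_self,
      Finsupp.single_eq_of_ne]
    simp [Fin.ext_iff]; omega
  have hφm : φ (f m) = 1 := by
    have := hb (Fin.last m)
    rw [Fin.val_last] at this
    rw [hφ, ← this, Module.Basis.coord_apply, Module.Basis.repr_self, Finsupp.single_eq_same]
  have horb : ∀ i, i ≤ m → ((T - E) ^ i) (f 0) = f i := by
    intro i
    induction i with
    | zero => intro; rfl
    | succ i ih =>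
      intro hi
      rw [pow_succ', Module.End.mul_apply, ih (by omega), LinearMap.sub_apply, hE, hf,
        hφf i (by omega), zero_smul, sub_zero]
  refine isNilpotent_of_span_orbit _ (f 0) (m + 1) ?_ ?_
  · rw [pow_succ', Module.End.mul_apply, horb m le_rfl, LinearMap.sub_apply, hE, hf, hφm, one_smul,
      sub_self]
  · rw [← b.span_eq, Submodule.span_le]
    rintro _ ⟨i, rfl⟩
    exact Submodule.subset_span ⟨i, by rw [hb]; exact horb i (by omega)⟩

/-- In characteristic two, a cyclic endomorphism of trace `0` of a space of dimension at least `3`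
is nil-clean. -/
theorem isNilCleanElem_of_cyclic_of_coord_eq_zero {V : Type*} [AddCommGroup V] [Module K V]
    (h2 : (-1 : K) = 1)
    (T : Module.End K V) (f : ℕ → V) (hf : ∀ i, T (f i) = f (i + 1)) (m : ℕ)
    (b : Module.Basis (Fin (m + 3)) K V) (hb : ∀ i, b i = f i)
    (ht : b.coord (Fin.last (m + 2)) (f (m + 3)) = 0) : IsNilCleanElem T := by
  have hcoord : ∀ (j : Fin (m + 3)) (i : ℕ), i < m + 3 →
      b.coord j (f i) = if i = (j : ℕ) then 1 else 0 := by
    intro j i hi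
    have := hb ⟨i, hi⟩
    rw [← this, Module.Basis.coord_apply, Module.Basis.repr_self, Finsupp.single_apply]
    simp [Fin.ext_iff]
  set ψ := b.coord (Fin.last (m + 2)) with hψ
  set χ := b.coord ⟨m + 1, by omega⟩ with hχ
  have hψf : ∀ i, i < m + 3 → ψ (f i) = if i = m + 2 then 1 else 0 :=
    fun i hi => hcoord _ i hi
  have hχf : ∀ i, i < m + 3 → χ (f i) = if i = m + 1 then 1 else 0 :=
    fun i hi => hcoord _ i hi
  -- This `c` makes `χ (T e) = 1`, whence `φ (T e) = 1 + 1 = 0`. The correction `c • f m` is what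
  -- needs dimension three.
  set c : K := χ (f (m + 3)) - 1 with hc
  set e : V := f (m + 2) - f (m + 1) - c • f m with he
  set a : V := f (m + 1) + c • f m with ha
  have hTe : T e = f (m + 3) - f (m + 2) - c • f (m + 1) := by
    rw [he, map_sub, map_sub, map_smul, hf, hf, hf]
  let φ := χ + ψ
  have hφ : ∀ x, φ x = χ x + ψ x := fun x => rfl
  -- `(φ, ψ)` is dual to `(a, T e)`, so `E` is idempotent; `T - E` sends `f (m + 1)` to `e` and `e`
  -- to `0`.
  let E : Module.End K V := φ.smulRight a + ψ.smulRight (T e)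
  have hE : ∀ x, E x = φ x • a + ψ x • T e := fun x => rfl
  have hψ0 : ψ (f m) = 0 := by rw [hψf _ (by omega), if_neg (by omega)]
  have hψ1 : ψ (f (m + 1)) = 0 := by rw [hψf _ (by omega), if_neg (by omega)]
  have hψ2 : ψ (f (m + 2)) = 1 := by rw [hψf _ (by omega), if_pos rfl]
  have hχ0 : χ (f m) = 0 := by rw [hχf _ (by omega), if_neg (by omega)]
  have hχ1 : χ (f (m + 1)) = 1 := by rw [hχf _ (by omega), if_pos rfl]
  have hχ2 : χ (f (m + 2)) = 0 := by rw [hχf _ (by omega), if_neg (by omega)]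
  have hψa : ψ a = 0 := by rw [ha, map_add, map_smul, hψ0, hψ1, smul_zero, add_zero]
  have hφa : φ a = 1 := by
    rw [hφ, hψa, ha, map_add, map_smul, hχ0, hχ1, smul_zero, add_zero, add_zero]
  have hψT : ψ (T e) = 1 := by
    rw [hTe, map_sub, map_sub, map_smul, ht, hψ1, hψ2, smul_zero, sub_zero, zero_sub, h2]
  have hφT : φ (T e) = 0 := by
    rw [hφ, hψT, hTe, map_sub, map_sub, map_smul, hχ1, hχ2, smul_eq_mul, hc]
    linear_combination -h2
  have hψe : ψ e = 1 := by
    rw [he, map_sub, map_sub, map_smul, hψ0, hψ1, hψ2, smul_zero, sub_zero, sub_zero]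
  have hφe : φ e = 0 := by
    rw [hφ, hψe, he, map_sub, map_sub, map_smul, hχ0, hχ1, hχ2, smul_zero, sub_zero, zero_sub,
      neg_add_cancel]
  refine ⟨E, LinearMap.ext fun x => ?_, ?_⟩
  · rw [Module.End.mul_apply, hE (E x)]
    have h1 : φ (E x) = φ x := by
      rw [hE, map_add, map_smul, map_smul, hφa, hφT, smul_zero, add_zero, smul_eq_mul, mul_one]
    have h2 : ψ (E x) = ψ x := by
      rw [hE, map_add, map_smul, map_smul, hψa, hψT, smul_zero, zero_add, smul_eq_mul, mul_one]
    rw [h1, h2, hE]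
  have horb : ∀ i, i ≤ m + 1 → ((T - E) ^ i) (f 0) = f i := by
    intro i
    induction i with
    | zero => intro; rfl
    | succ i ih =>
      intro hi
      rw [pow_succ', Module.End.mul_apply, ih (by omega), LinearMap.sub_apply, hE, hf, hφ,
        hψf i (by omega), hχf i (by omega), if_neg (by omega), if_neg (by omega), add_zero,
        zero_smul, zero_smul, add_zero, sub_zero]
  have horbe : ((T - E) ^ (m + 2)) (f 0) = e := by
    rw [pow_succ', Module.End.mul_apply, horb _ le_rfl, LinearMap.sub_apply, hE, hf, hφ, hψ1, hχ1,
      zero_smul, add_zero, add_zero, one_smul, ha, he]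
    abel
  refine isNilpotent_of_span_orbit _ (f 0) (m + 3) ?_ ?_
  · rw [pow_succ', Module.End.mul_apply, horbe, LinearMap.sub_apply, hE, hφe, hψe, one_smul,
      zero_smul, zero_add, sub_self]
  · set U := Submodule.span K (Set.range fun i : ℕ => ((T - E) ^ i) (f 0)) with hU
    have hmem : ∀ i, i ≤ m + 1 → f i ∈ U := fun i hi => Submodule.subset_span ⟨i, horb i hi⟩
    have hmem' : f (m + 2) ∈ U := by
      have : f (m + 2) = e + f (m + 1) + c • f m := by rw [he]; abel
      rw [this]
      exact U.add_mem (U.add_mem (Submodule.subset_span ⟨m + 2, horbe⟩) (hmem _ le_rfl))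
        (U.smul_mem _ (hmem _ (by omega)))
    rw [← b.span_eq, Submodule.span_le]
    rintro _ ⟨i, rfl⟩
    rw [hb]
    by_cases hi : (i : ℕ) ≤ m + 1
    · exact hmem _ hi
    · rw [show (i : ℕ) = m + 2 by omega]; exact hmem'

/-- A cyclic endomorphism over the field with two elements is nil-clean. -/
theorem isNilCleanElem_of_cyclic (hK : ∀ x : K, x = 0 ∨ x = 1)
    {V : Type*} [AddCommGroup V] [Module K V]
    (T : Module.End K V) (f : ℕ → V) (hf : ∀ i, T (f i) = f (i + 1)) (d : ℕ)
    (b : Module.Basis (Fin d) K V) (hb : ∀ i, b i = f i) : IsNilCleanElem T := by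
  have h2 : (-1 : K) = 1 := (hK (-1)).resolve_left (by simp)
  match d, b, hb with
  | 0, b, _ =>
    have hT : T = 0 := b.ext fun i => i.elim0
    rw [hT]
    exact IsIdempotentElem.zero.isNilCleanElem
  | m + 1, b, hb =>
    rcases hK (b.coord (Fin.last m) (f (m + 1))) with h0 | h1
    swap
    · exact isNilCleanElem_of_cyclic_of_coord_eq_one T f hf m b hb h1
    match m, b, hb, h0 with
    | 0, b, hb, h0 =>
      have hT : T = 0 := by
        refine b.ext fun i => ?_
        rw [hb, hf]
        have := b.sum_repr (f (i + 1))
        fin_cases i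
        simp at this h0
        simp [h0] at this
        simp [← this]
      rw [hT]
      exact IsIdempotentElem.zero.isNilCleanElem
    | 1, b, hb, h0 =>
      set γ := b.repr (f 2) 0 with hγ
      have hf2 : f 2 = γ • f 0 := by
        have := b.sum_repr (f 2)
        rw [Fin.sum_univ_two, hb, hb] at this
        have h0' : b.repr (f 2) 1 = 0 := h0
        rw [h0', zero_smul, add_zero] at this
        exact this.symm
      have hTT : T * T = γ • 1 := by
        refine b.ext fun i => ?_
        rw [Module.End.mul_apply, hb, hf, hf, LinearMap.smul_apply, Module.End.one_apply]
        fin_cases i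
        · exact hf2
        · change f 3 = γ • f 1
          rw [← hf, hf2, map_smul, hf]
      -- Either `T` squares to zero, or `T - 1` does by characteristic two.
      rcases hK γ with h | h
      · exact ⟨0, IsIdempotentElem.zero, 2, by rw [sub_zero, pow_two, hTT, h, zero_smul]⟩
      · refine ⟨1, IsIdempotentElem.one, 2, ?_⟩
        have h11 : (1 : Module.End K V) + 1 = 0 := by
          ext x
          have : (1 : K) + 1 = 0 := by nth_rewrite 1 [← h2]; ring
          simp [← two_smul K x, ← one_add_one_eq_two, this]
        rw [pow_two, sub_mul, mul_sub, mul_sub, hTT, h, one_smul, one_mul, mul_one, one_mul]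
        calc (1 : Module.End K V) - T - (T - 1) = (1 + 1) - (1 + 1) * T := by noncomm_ring
          _ = 0 := by rw [h11, zero_mul, sub_zero]
    | m + 2, b, hb, h0 => exact isNilCleanElem_of_cyclic_of_coord_eq_zero h2 T f hf m b hb h0

/-- Krylov subspaces: every vector generates an invariant subspace with a basis of iterates. -/
theorem exists_basis_orbit {V : Type*} [AddCommGroup V] [Module K V] [FiniteDimensional K V]
    (T : Module.End K V) (v : V) : ∃ d : ℕ,
      LinearIndependent K (fun i : Fin d => (T ^ (i : ℕ)) v) ∧
      (T ^ d) v ∈ Submodule.span K (Set.range fun i : Fin d => (T ^ (i : ℕ)) v) := by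
  by_contra! h
  have hli : ∀ d : ℕ, LinearIndependent K (fun i : Fin d => (T ^ (i : ℕ)) v) := by
    intro d
    induction d with
    | zero => exact linearIndependent_empty_type
    | succ d ih =>
      rw [linearIndependent_finSucc']
      exact ⟨ih, h d ih⟩
  have := (hli (Module.finrank K V + 1)).fintype_card_le_finrank
  simp at this

/-- Every endomorphism of a finite-dimensional space over the field with two elements is
nil-clean. -/
theorem isNilCleanRing_end (hK : ∀ x : K, x = 0 ∨ x = 1) (n : ℕ) :
    ∀ (V : Type*) [AddCommGroup V] [Module K V] [FiniteDimensional K V],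
      Module.finrank K V = n → IsNilCleanRing (Module.End K V) := by
  induction n using Nat.strong_induction_on with
  | _ n ih =>
  intro V _ _ _ hn T
  rcases subsingleton_or_nontrivial V with hV | hV
  · exact IsIdempotentElem.isNilCleanElem (Subsingleton.elim _ _)
  obtain ⟨v, hv⟩ := exists_ne (0 : V)
  obtain ⟨d, hli, hd⟩ := exists_basis_orbit T v
  set W := Submodule.span K (Set.range fun i : Fin d => (T ^ (i : ℕ)) v) with hWdef
  have hmem : ∀ i : ℕ, i < d → (T ^ i) v ∈ W := fun i hi => Submodule.subset_span ⟨⟨i, hi⟩, rfl⟩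
  have hW : ∀ x ∈ W, T x ∈ W := by
    suffices W ≤ W.comap T from this
    rw [hWdef, Submodule.span_le]
    rintro _ ⟨i, rfl⟩
    change T ((T ^ (i : ℕ)) v) ∈ W
    rw [← Module.End.mul_apply, ← pow_succ']
    rcases Nat.lt_or_ge (i + 1) d with h | h
    · exact hmem _ h
    · rw [show (i : ℕ) + 1 = d by omega]; exact hd
  have hvW : v ∈ W := by
    rcases Nat.eq_zero_or_pos d with h | h
    · subst h; exact hd
    · exact hmem 0 h
  refine isNilCleanElem_of_invariant T W hW ?_ ?_
  · refine isNilCleanElem_of_cyclic hK (T.restrict hW)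
      (fun i => ((T.restrict hW) ^ i) ⟨v, hvW⟩) (fun i => ?_) d (Module.Basis.span hli) fun i => ?_
    · rw [pow_succ', Module.End.mul_apply]
    · apply Subtype.ext
      rw [Module.Basis.span_apply, Module.End.pow_restrict]
      rfl
  · refine ih (Module.finrank K (V ⧸ W)) ?_ _ rfl _
    rw [← hn, ← W.finrank_quotient_add_finrank]
    have : Nontrivial W := ⟨⟨⟨v, hvW⟩, 0, fun h => hv (congrArg Subtype.val h)⟩⟩
    have := Module.finrank_pos (R := K) (M := W)
    omega

end Field

theorem isNilCleanRing_matrix_field {K ι : Type*} [Field K] [Fintype ι] [DecidableEq ι]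
    (hK : ∀ x : K, x = 0 ∨ x = 1) : IsNilCleanRing (Matrix ι ι K) := fun _ =>
  IsNilCleanElem.of_ringEquiv (Matrix.toLinAlgEquiv' (R := K) (n := ι)).toRingEquiv
    (isNilCleanRing_end hK _ (ι → K) rfl _)

/-! ### Boolean coefficients and the equivalence -/

/-- Matrix rings over finite Boolean rings are nil-clean. -/
theorem isNilCleanRing_matrix_of_finite {B ι : Type*} [CommRing B] [Finite B] [Fintype ι]
    [DecidableEq ι] (hB : IsBooleanRing B) : IsNilCleanRing (Matrix ι ι B) := by
  have : IsReduced B := ⟨fun x ⟨k, hk⟩ => by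
    have := (hB x).pow_succ_eq k
    rw [← this, pow_succ, hk, zero_mul]⟩
  let φ : Matrix ι ι B ≃+* ∀ I : MaximalSpectrum B, Matrix ι ι (B ⧸ I.asIdeal) :=
    (IsArtinianRing.equivPi B).toRingEquiv.mapMatrix.trans Matrix.piRingEquiv
  intro A
  refine IsNilCleanElem.of_ringEquiv φ (IsNilCleanRing.pi (fun I => ?_) _)
  let _ : Field (B ⧸ I.asIdeal) := Ideal.Quotient.field _
  refine isNilCleanRing_matrix_field fun x => ?_
  obtain ⟨y, rfl⟩ := Ideal.Quotient.mk_surjective x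
  exact IsIdempotentElem.iff_eq_zero_or_one.1 ((hB y).map (Ideal.Quotient.mk I.asIdeal))

/-- Matrix rings over Boolean rings are nil-clean. -/
theorem IsBooleanRing.isNilCleanRing_matrix {B ι : Type*} [Ring B] [Fintype ι]
    [DecidableEq ι] (hB : IsBooleanRing B) : IsNilCleanRing (Matrix ι ι B) := by
  let _ : BooleanRing B := { ‹Ring B› with isIdempotentElem := fun a => hB a }
  intro A
  -- The entries are integral (roots of `X ^ 2 - X`), so `S` is a finite `ℤ`-module; being killed by
  -- `2`, it is a finite ring.
  let S := Algebra.adjoin ℤ (Set.range fun p : ι × ι => A p.1 p.2)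
  have hfin : Module.Finite ℤ S := by
    refine Algebra.finite_adjoin_of_finite_of_isIntegral (Set.finite_range _) fun x _ => ?_
    refine ⟨Polynomial.X ^ 2 - Polynomial.X, Polynomial.monic_X_pow_sub (by simp), ?_⟩
    rw [Polynomial.eval₂_sub, Polynomial.eval₂_X_pow, Polynomial.eval₂_X, pow_two, (hB x).eq,
      sub_self]
  have htor : Module.IsTorsion ℤ S := fun {x} =>
    ⟨⟨2, mem_nonZeroDivisors_of_ne_zero two_ne_zero⟩, Subtype.ext (by
      change (2 : ℤ) • (x : B) = 0
      rw [two_smul, BooleanRing.add_self])⟩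
  have : Finite S := Module.finite_of_fg_torsion S htor
  have hS : IsBooleanRing S := fun x => Subtype.ext (hB x)
  exact (isNilCleanRing_matrix_of_finite (ι := ι) hS
    (Matrix.of fun i j => ⟨A i j, Algebra.subset_adjoin ⟨(i, j), rfl⟩⟩)).map
      (S.val : S →+* B).mapMatrix

theorem theorem2p6 {R : Type*} [Ring R] (hR : IsAbelianRing R) (n : ℕ) (hn : 1 ≤ n) :
    IsNilCleanRing (Matrix (Fin n) (Fin n) R) ↔
      IsBooleanRing (R ⧸ Ring.jacobson R) ∧
        IsNilIdeal ((Ring.jacobson R).matrix (Fin n)) := by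
  refine ⟨fun h => ⟨h.isBooleanRing_quotient_jacobson hR ⟨0, hn⟩, h.isNilIdeal_matrix_jacobson⟩,
    fun ⟨hB, hJ⟩ => ?_⟩
  refine IsNilCleanRing.of_ker_isNilpotent (Ideal.Quotient.mk (Ring.jacobson R)).mapMatrix
    (RingHom.mapMatrix_surjective Ideal.Quotient.mk_surjective) (fun A hA => hJ A ?_)
    hB.isNilCleanRing_matrix
  refine (Ideal.mem_matrix _ _ A).2 fun i j => Ideal.Quotient.eq_zero_iff_mem.1 ?_
  have hA0 := RingHom.mem_ker.1 hA
  exact congrFun (congrFun hA0 i) j
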